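/- Let $(W,S)$ be a Coxeter system with $S=\{s_1,\dots,s_n\}$ finite and with exponents $m_{ij}$ ($m_{ii}=1$, $m_{ij}=m_{ji}\in\{2,3,\dots\}\cup\{\infty\}$ for $i\ne j$), and suppose that $W$ is odd-angled, i.e. every $m_{ij}$ is odd or infinite. Let $\mathrm{Cox}_{\mathrm{div}}(W)$ be the divisibility diagram of $(W,S)$: its vertices are the elements of $S$, and distinct $s_i,s_j$ are joined (by an edge labelled by the least divisor greater than $1$ of $m_{ij}$) if and only if $m_{ij}<\infty$. Let $C_1,\dots,C_k$ be its connected components, let $S_i\subset S$ be the set of vertices of $C_i$, and let $(W_i,S_i)$ be the Coxeter system with generating set $S_i$ and the exponents of $(W,S)$ restricted to $S_i$. Then $W=W_1*W_2*\dots*W_k$, by the isomorphism that is the identity on the generators; and $W$ contains a proper finite-index reflection subgroup if and only if at least one of $W_1,\dots,W_k$ contains one. Here a reflection of a Coxeter system is a conjugate of a generator, and a proper finite-index reflection subgroup is a subgroup generated by a (possibly empty) set of reflections whose index is finite and greater than $1$. -/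

import Mathlib

/-- A Coxeter matrix is *odd-angled* if all its entries are odd or infinite
(the value `0` encodes `∞`). -/
def CoxeterMatrix.IsOddAngled {B : Type*} (M : CoxeterMatrix B) : Prop :=
  ∀ i j : B, M i j = 0 ∨ Odd (M i j)

/-- The underlying graph of the divisibility diagram: the vertices are the (indices of the)
generating reflections, and two distinct vertices are joined if and only if `m i j` is finite
(the value `0` encodes `∞`). The label of an edge, which is the least non-trivial divisor
`(M i j).minFac`, plays no role for the connected components. -/
def CoxeterMatrix.divGraph {B : Type*} (M : CoxeterMatrix B) : SimpleGraph B where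
  Adj i j := i ≠ j ∧ M i j ≠ 0
  symm := ⟨fun i j h => ⟨h.1.symm, by rw [M.symmetric j i]; exact h.2⟩⟩
  loopless := ⟨fun _ h => h.1 rfl⟩

/-- The Coxeter matrix obtained by keeping only the generators in `s`. -/
def CoxeterMatrix.restrict {B : Type*} (M : CoxeterMatrix B) (s : Set B) : CoxeterMatrix s where
  M := M.M.submatrix Subtype.val Subtype.val
  isSymm := M.isSymm.submatrix _
  diagonal i := M.diagonal i
  off_diagonal i j h := M.off_diagonal i j (fun e => h (Subtype.ext e))

/-- The subgroup `V` is generated by reflections of the Coxeter system, that is, by conjugates of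
the generators (the trivial subgroup is generated by the empty set of reflections). -/
def CoxeterSystem.IsReflectionSubgroup {B W : Type*} [Group W] {M : CoxeterMatrix B}
    (cs : CoxeterSystem M W) (V : Subgroup W) : Prop :=
  ∃ R : Set W, (∀ t ∈ R, cs.IsReflection t) ∧ V = Subgroup.closure R

/-- The group has a subgroup `V` generated by reflections whose index satisfies
`1 < [W : V] < ∞`. -/
def CoxeterSystem.HasProperFiniteIndexReflectionSubgroup {B W : Type*} [Group W]
    {M : CoxeterMatrix B} (cs : CoxeterSystem M W) : Prop :=
  ∃ V : Subgroup W, cs.IsReflectionSubgroup V ∧ V ≠ ⊤ ∧ V.FiniteIndex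

open Monoid

/-! Generators in different components satisfy no common relation, so `W` is the free product of the
component groups `W_c`. A reflection subgroup of `W_c` is pulled back along the retraction of `W`
onto `W_c` that kills the other components; the kernel is generated by conjugates of the killed
generators, so the preimage is again generated by reflections. Conversely, for every reflection
subgroup `V`, the trace of `V` on `W_c` is a reflection subgroup
(`isReflectionSubgroup_comap_componentHom`). If no trace is proper of finite index, `V` contains
every generator. -/

theorem finiteIndex_comap {G G' : Type*} [Group G] [Group G'] (f : G →* G') (V : Subgroup G')
    [V.FiniteIndex] : (V.comap f).FiniteIndex :=
  ⟨by rw [Subgroup.index_comap]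
      exact fun h => V.index_ne_zero_of_finite (Subgroup.index_eq_zero_of_relIndex_eq_zero h)⟩

/-! ### Free product decomposition and retractions onto components. -/

section FreeProduct

variable {B W : Type*} [Group W] {M : CoxeterMatrix B}

theorem CoxeterMatrix.restrict_apply (M : CoxeterMatrix B) (s : Set B) (i j : s) :
    M.restrict s i j = M i j := rfl

variable (cs : CoxeterSystem M W) {G : M.divGraph.ConnectedComponent → Type*} [∀ c, Group (G c)]
  (cs' : ∀ c, CoxeterSystem (M.restrict c.supp) (G c))

/-- The homomorphism from the Coxeter group of a component that is the identity on generators. -/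
noncomputable def componentHom (c : M.divGraph.ConnectedComponent) : G c →* W :=
  (cs' c).lift ⟨fun b => cs.simple b, fun i j => cs.simple_mul_simple_pow i j⟩

theorem componentHom_simple (c : M.divGraph.ConnectedComponent) (b : c.supp) :
    componentHom cs cs' c ((cs' c).simple b) = cs.simple b :=
  (cs' c).lift_apply_simple _ b

/-- The image of a generator in the free product of the groups of the components. -/
noncomputable def coprodSimple (b : B) : CoprodI G :=
  CoprodI.of ((cs' (M.divGraph.connectedComponentMk b)).simple ⟨b, rfl⟩)

theorem coprodSimple_eq (c : M.divGraph.ConnectedComponent) (b : c.supp) :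
    coprodSimple cs' b = CoprodI.of ((cs' c).simple b) := by
  obtain ⟨b, hb⟩ := b
  have hb' : M.divGraph.connectedComponentMk b = c := hb
  subst hb'
  rfl

/-- A zero exponent imposes no relation; a nonzero one forces both generators into the same
component. -/
theorem isLiftable_coprodSimple : M.IsLiftable (coprodSimple cs') := by
  intro i j
  by_cases hij : M i j = 0
  · rw [hij, pow_zero]
  have hj : M.divGraph.connectedComponentMk j = M.divGraph.connectedComponentMk i := by
    by_cases h : i = j
    · rw [h]
    · exact (SimpleGraph.ConnectedComponent.connectedComponentMk_eq_of_adj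
        (show M.divGraph.Adj i j from ⟨h, hij⟩)).symm
  have h1 := coprodSimple_eq cs' (M.divGraph.connectedComponentMk i) ⟨i, rfl⟩
  have h2 := coprodSimple_eq cs' (M.divGraph.connectedComponentMk i) ⟨j, hj⟩
  have h3 := (cs' (M.divGraph.connectedComponentMk i)).simple_mul_simple_pow ⟨i, rfl⟩ ⟨j, hj⟩
  rw [M.restrict_apply] at h3
  rw [h1, h2, ← map_mul, ← map_pow, h3, map_one]

/-- A Coxeter group is the free product of the Coxeter groups of the connected components of its
divisibility diagram. -/
noncomputable def coprodEquiv : CoprodI G ≃* W :=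
  MonoidHom.toMulEquiv (CoprodI.lift (componentHom cs cs'))
    (cs.lift ⟨coprodSimple cs', isLiftable_coprodSimple cs'⟩)
    (by
      refine CoprodI.ext_hom _ _ fun c => (cs' c).ext_simple fun b => ?_
      simp only [MonoidHom.comp_apply, CoprodI.lift_of, componentHom_simple,
        MonoidHom.id_apply]
      rw [cs.lift_apply_simple, coprodSimple_eq])
    (by
      refine cs.ext_simple fun b => ?_
      simp only [MonoidHom.comp_apply, MonoidHom.id_apply]
      rw [cs.lift_apply_simple, coprodSimple, CoprodI.lift_of, componentHom_simple])

theorem coprodEquiv_of (c : M.divGraph.ConnectedComponent) (g : G c) :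
    coprodEquiv cs cs' (CoprodI.of g) = componentHom cs cs' c g :=
  CoprodI.lift_of _ _

theorem exists_hom_extending {N : Type*} [Monoid N] (f : ∀ c, G c →* N) :
    ∃ F : W →* N, ∀ c g, F (componentHom cs cs' c g) = f c g := by
  refine ⟨(CoprodI.lift f).comp (coprodEquiv cs cs').symm.toMonoidHom, fun c g => ?_⟩
  rw [← coprodEquiv_of]
  simp

theorem exists_component_simple (b : B) :
    ∃ (c : M.divGraph.ConnectedComponent) (b' : c.supp),
      cs.simple b = componentHom cs cs' c ((cs' c).simple b') :=
  ⟨M.divGraph.connectedComponentMk b, ⟨b, rfl⟩,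
    (componentHom_simple cs cs' (M.divGraph.connectedComponentMk b) ⟨b, rfl⟩).symm⟩

theorem isReflection_componentHom {c : M.divGraph.ConnectedComponent} {t : G c}
    (ht : (cs' c).IsReflection t) : cs.IsReflection (componentHom cs cs' c t) := by
  obtain ⟨w, b, rfl⟩ := ht
  exact ⟨componentHom cs cs' c w, b, by simp [componentHom_simple]⟩

theorem hasProperFiniteIndexReflectionSubgroup_of_component {c : M.divGraph.ConnectedComponent}
    (h : (cs' c).HasProperFiniteIndexReflectionSubgroup) :
    cs.HasProperFiniteIndexReflectionSubgroup := by
  classical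
  obtain ⟨V, ⟨R, hR, rfl⟩, hne, hfin⟩ := h
  obtain ⟨π, hπ⟩ := exists_hom_extending cs cs'
    (Function.update (fun d => (1 : G d →* G c)) c (MonoidHom.id (G c)))
  have hπc : ∀ g, π (componentHom cs cs' c g) = g := fun g => by simp [hπ]
  have hπd : ∀ d, d ≠ c → ∀ g, π (componentHom cs cs' d g) = 1 := fun d hd g => by simp [hπ, hd]
  let N := Subgroup.normalClosure {t | (∃ b, t = cs.simple b) ∧ π t = 1}
  -- Modulo `N` every element equals its retraction, so `N` contains the kernel of `π`.
  have key : ∀ w, (componentHom cs cs' c (π w))⁻¹ * w ∈ N := by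
    intro w
    induction w using cs.simple_induction with
    | simple b =>
      obtain ⟨d, b', hb⟩ := exists_component_simple cs cs' b
      by_cases hd : d = c
      · subst hd
        rw [hb, hπc]
        simp
      · have h1 : π (cs.simple b) = 1 := by rw [hb, hπd d hd]
        rw [h1]
        have h2 : cs.simple b ∈ {t | (∃ b, t = cs.simple b) ∧ π t = 1} := ⟨⟨b, rfl⟩, h1⟩
        simpa using Subgroup.subset_normalClosure h2
    | one => simp
    | mul w w' hw hw' =>
      have h1 := mul_mem ((Subgroup.normalClosure_normal (s := {t | (∃ b, t = cs.simple b) ∧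
        π t = 1})).conj_mem _ hw (componentHom cs cs' c (π w'))⁻¹) hw'
      convert h1 using 1
      simp only [map_mul]
      group
  refine ⟨(Subgroup.closure R).comap π,
    ⟨{t | cs.IsReflection t ∧ π t ∈ Subgroup.closure R}, fun t ht => ht.1, ?_⟩, ?_,
    finiteIndex_comap _ _⟩
  · refine le_antisymm (fun w hw => ?_) ((Subgroup.closure_le _).2 fun t ht => ht.2)
    have hN : N ≤ Subgroup.closure {t | cs.IsReflection t ∧ π t ∈ Subgroup.closure R} := by
      refine Subgroup.closure_mono fun t ht => ?_
      obtain ⟨s, ⟨⟨b, rfl⟩, hs⟩, hst⟩ := Group.mem_conjugatesOfSet_iff.1 ht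
      obtain ⟨g, rfl⟩ := isConj_iff.1 hst
      exact ⟨⟨g, b, rfl⟩, by simp [hs]⟩
    have hV : (Subgroup.closure R).map (componentHom cs cs' c) ≤
        Subgroup.closure {t | cs.IsReflection t ∧ π t ∈ Subgroup.closure R} := by
      rw [MonoidHom.map_closure]
      refine Subgroup.closure_mono ?_
      rintro _ ⟨t, ht, rfl⟩
      exact ⟨isReflection_componentHom cs cs' (hR t ht), by
        rw [hπc]; exact Subgroup.subset_closure ht⟩
    have := mul_mem (hV (Subgroup.mem_map_of_mem _ hw)) (hN (key w))
    simpa using this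
  · intro htop
    refine hne ((Subgroup.eq_top_iff' _).2 fun g => ?_)
    have : componentHom cs cs' c g ∈ (Subgroup.closure R).comap π := htop ▸ Subgroup.mem_top _
    rwa [Subgroup.mem_comap, hπc] at this

end FreeProduct

/-! ### Cocycles from orbit sections. -/

section OrbitCocycle

variable {H X : Type*} [Group H] [MulAction H X] (x₀ : X)

open Classical in
/-- A choice of elements carrying a base point to the points of its orbit. -/
noncomputable def orbitSection (x : X) : H :=
  if h : ∃ g : H, g • x₀ = x then h.choose else 1

theorem orbitSection_smul {x : X} (h : ∃ g : H, g • x₀ = x) :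
    (orbitSection x₀ x : H) • x₀ = x := by
  rw [orbitSection, dif_pos h]
  exact h.choose_spec

open Classical in
/-- The cocycle with values in the stabilizer of `x₀` that is given by a section over the orbit of
`x₀`, and is trivial on the other orbits. -/
noncomputable def orbitCocycle (h : H) (x : X) : H :=
  if ∃ g : H, g • x₀ = x then (orbitSection x₀ (h • x))⁻¹ * h * orbitSection x₀ x else 1

theorem exists_smul_eq_smul_iff (h : H) (x : X) :
    (∃ g : H, g • x₀ = h • x) ↔ ∃ g : H, g • x₀ = x := by
  constructor
  · rintro ⟨g, hg⟩
    exact ⟨h⁻¹ * g, by rw [mul_smul, hg, inv_smul_smul]⟩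
  · rintro ⟨g, hg⟩
    exact ⟨h * g, by rw [mul_smul, hg]⟩

theorem orbitCocycle_one (x : X) : orbitCocycle x₀ (1 : H) x = 1 := by
  unfold orbitCocycle
  split_ifs <;> simp

theorem orbitCocycle_mul (h h' : H) (x : X) :
    orbitCocycle x₀ (h * h') x = orbitCocycle x₀ h (h' • x) * orbitCocycle x₀ h' x := by
  by_cases hx : ∃ g : H, g • x₀ = x
  · simp only [orbitCocycle, if_pos hx, if_pos ((exists_smul_eq_smul_iff x₀ h' x).2 hx), mul_smul]
    group
  · simp only [orbitCocycle, if_neg hx, if_neg (mt (exists_smul_eq_smul_iff x₀ h' x).1 hx),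
      mul_one]

theorem orbitCocycle_mem (h : H) (x : X) : orbitCocycle x₀ h x ∈ MulAction.stabilizer H x₀ := by
  unfold orbitCocycle
  split_ifs with hx
  · rw [MulAction.mem_stabilizer_iff, mul_smul, mul_smul, orbitSection_smul x₀ hx, inv_smul_eq_iff,
      orbitSection_smul x₀ ((exists_smul_eq_smul_iff x₀ h x).2 hx)]
  · exact one_mem _

/-- The action on `X × H` twisted by the orbit cocycle. -/
noncomputable def twistedAction : H →* Function.End (X × H) where
  toFun h p := (h • p.1, orbitCocycle x₀ h p.1 * p.2)
  map_one' := by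
    funext p
    simp only [one_smul, orbitCocycle_one, one_mul]
    rfl
  map_mul' h h' := by
    funext p
    change _ = ((h • h' • p.1, orbitCocycle x₀ h (h' • p.1) * (orbitCocycle x₀ h' p.1 * p.2)) : X × H)
    rw [orbitCocycle_mul, mul_smul, mul_assoc]

/-- The action on `X × H` through the first factor. -/
def untwistedAction (K H X : Type*) [Monoid K] [MulAction K X] : K →* Function.End (X × H) where
  toFun k p := (k • p.1, p.2)
  map_one' := by
    funext p
    simp only [one_smul]
    rfl
  map_mul' k k' := by
    funext p
    change _ = ((k • k' • p.1, p.2) : X × H)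
    rw [mul_smul]

end OrbitCocycle

/-! ### Traces of reflection subgroups on components. -/

section Intersection

variable {B W : Type*} [Group W] {M : CoxeterMatrix B}
  (cs : CoxeterSystem M W) {G : M.divGraph.ConnectedComponent → Type*} [∀ c, Group (G c)]
  (cs' : ∀ c, CoxeterSystem (M.restrict c.supp) (G c))

/-- By freeness, `W` acts on `(W ⧸ V) × G c` with only the factor `G c` twisted by the cocycle. Over
the base coset, reflections in `V` shift the fibre by `1` or by a reflection in the trace, while
elements of the trace shift it by conjugates of themselves. -/
theorem isReflectionSubgroup_comap_componentHom {V : Subgroup W} (hV : cs.IsReflectionSubgroup V)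
    (c : M.divGraph.ConnectedComponent) :
    (cs' c).IsReflectionSubgroup (V.comap (componentHom cs cs' c)) := by
  classical
  obtain ⟨R, hR, hVR⟩ := hV
  let act : ∀ d, MulAction (G d) (W ⧸ V) := fun d =>
    MulAction.compHom (W ⧸ V) (componentHom cs cs' d)
  have act_def : ∀ d (g : G d) (x : W ⧸ V), g • x = componentHom cs cs' d g • x :=
    fun _ _ _ => rfl
  let x₀ : W ⧸ V := ((1 : W) : W ⧸ V)
  have hx₀ : ∀ w : W, w • x₀ = x₀ ↔ w ∈ V := fun w => by
    rw [← MulAction.mem_stabilizer_iff, MulAction.stabilizer_quotient]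
  let A := V.comap (componentHom cs cs' c)
  have hA : MulAction.stabilizer (G c) x₀ = A := by
    ext g
    rw [MulAction.mem_stabilizer_iff, act_def, hx₀, Subgroup.mem_comap]
  obtain ⟨F, hF⟩ := exists_hom_extending cs cs'
    (Function.update (fun d => untwistedAction (G d) (G c) (W ⧸ V)) c (twistedAction x₀))
  have hFc : ∀ (g : G c) x q, F (componentHom cs cs' c g) (x, q) =
      (g • x, orbitCocycle x₀ g x * q) := fun g x q => by
    rw [hF, Function.update_self]; rfl
  have hFd : ∀ d, d ≠ c → ∀ (g : G d) x q, F (componentHom cs cs' d g) (x, q) = (g • x, q) :=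
    fun d hd g x q => by
      rw [hF, Function.update_of_ne hd]; rfl
  have hFmul : ∀ w w' p, F (w * w') p = F w (F w' p) := fun w w' p => by
    rw [map_mul]; rfl
  have hF1 : ∀ p, F 1 p = p := fun p => by
    rw [map_one]; rfl
  have shift : ∀ w x, ∃ k ∈ A, ∀ q, F w (x, q) = (w • x, k * q) := by
    intro w
    induction w using cs.simple_induction with
    | simple b =>
      intro x
      obtain ⟨d, b', hb⟩ := exists_component_simple cs cs' b
      rw [hb]
      by_cases hd : d = c
      · subst hd
        exact ⟨_, hA ▸ orbitCocycle_mem x₀ _ x, fun q => hFc _ x q⟩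
      · exact ⟨1, one_mem _, fun q => by rw [hFd d hd, one_mul]; rfl⟩
    | one => exact fun x => ⟨1, one_mem _, fun q => by rw [hF1, one_smul, one_mul]⟩
    | mul w w' hw hw' =>
      intro x
      obtain ⟨k', hk', h'⟩ := hw' x
      obtain ⟨k, hk, h⟩ := hw (w' • x)
      exact ⟨k * k', mul_mem hk hk', fun q => by rw [hFmul, h', h, mul_smul, mul_assoc]⟩
  -- At a fixed point the cocycle of a generator is its conjugate by the section, hence a
  -- reflection.
  have shift_simple : ∀ b x, cs.simple b • x = x →
      ∃ k, (k = 1 ∨ k ∈ A ∧ (cs' c).IsReflection k) ∧ ∀ q, F (cs.simple b) (x, q) = (x, k * q) := by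
    intro b x hx
    obtain ⟨d, b', hb⟩ := exists_component_simple cs cs' b
    rw [hb] at hx ⊢
    by_cases hd : d = c
    · subst hd
      have hx' : (cs' d).simple b' • x = x := hx
      refine ⟨orbitCocycle x₀ ((cs' d).simple b') x, ?_, fun q => by rw [hFc, hx']⟩
      by_cases ho : ∃ g : G d, g • x₀ = x
      · refine Or.inr ⟨hA ▸ orbitCocycle_mem x₀ _ x, (orbitSection x₀ x)⁻¹, b', ?_⟩
        rw [orbitCocycle, if_pos ho, hx', inv_inv]
      · exact Or.inl (if_neg ho)
    · refine ⟨1, Or.inl rfl, fun q => by rw [hFd d hd, one_mul]; exact Prod.ext hx rfl⟩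
  let T : Set (G c) := {t | (cs' c).IsReflection t ∧ t ∈ A}
  have shift_mem : ∀ v ∈ V, ∃ k ∈ Subgroup.closure T, ∀ q, F v (x₀, q) = (x₀, k * q) := by
    intro v hv
    rw [hVR] at hv
    induction hv using Subgroup.closure_induction with
    | mem t ht =>
      have htV : t ∈ V := hVR ▸ Subgroup.subset_closure ht
      obtain ⟨w, b, rfl⟩ := hR t ht
      obtain ⟨k₁, hk₁, h₁⟩ := shift w⁻¹ x₀
      obtain ⟨k₂, -, h₂⟩ := shift w (w⁻¹ • x₀)
      have hfix : cs.simple b • w⁻¹ • x₀ = w⁻¹ • x₀ := by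
        have := (hx₀ _).2 htV
        rw [mul_smul, mul_smul] at this
        rw [eq_inv_smul_iff, this]
      obtain ⟨k, hk, h⟩ := shift_simple b _ hfix
      -- The shifts along `w⁻¹` and back along `w` cancel.
      have hk₂ : k₂ = k₁⁻¹ := by
        have := hFmul w w⁻¹ (x₀, 1)
        rw [mul_inv_cancel, hF1, h₁, h₂] at this
        have := congrArg Prod.snd this
        exact eq_inv_of_mul_eq_one_left (by simpa using this.symm)
      refine ⟨k₁⁻¹ * k * k₁, ?_, fun q => ?_⟩
      · rcases hk with rfl | ⟨hkA, hkr⟩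
        · simp
        · refine Subgroup.subset_closure ⟨?_, mul_mem (mul_mem (inv_mem hk₁) hkA) hk₁⟩
          simpa using hkr.conj k₁⁻¹
      · rw [hFmul, hFmul, h₁, h, h₂, hk₂, smul_inv_smul, mul_assoc, mul_assoc]
    | one => exact ⟨1, one_mem _, fun q => by rw [hF1, one_mul]⟩
    | mul v v' _ _ h h' =>
      obtain ⟨k, hk, h⟩ := h
      obtain ⟨k', hk', h'⟩ := h'
      exact ⟨k * k', mul_mem hk hk', fun q => by rw [hFmul, h', h, mul_assoc]⟩
    | inv v _ h =>
      obtain ⟨k, hk, h⟩ := h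
      refine ⟨k⁻¹, inv_mem hk, fun q => ?_⟩
      have := hFmul v⁻¹ v (x₀, k⁻¹ * q)
      rw [inv_mul_cancel, hF1, h, mul_inv_cancel_left] at this
      exact this.symm
  refine ⟨T, fun t ht => ht.1, le_antisymm (fun a ha => ?_)
    ((Subgroup.closure_le _).2 fun t ht => ht.2)⟩
  have ho : ∃ g : G c, g • x₀ = x₀ := ⟨1, one_smul _ _⟩
  -- The section at `x₀` need not be `1`; conjugating `a` by it first makes the shift exactly `a`.
  let r : G c := orbitSection x₀ x₀
  have hr : r ∈ A := hA ▸ orbitSection_smul x₀ ho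
  have har : r * a * r⁻¹ ∈ A := mul_mem (mul_mem hr ha) (inv_mem hr)
  obtain ⟨k, hk, h⟩ := shift_mem _ (Subgroup.mem_comap.1 har)
  have hfix : (r * a * r⁻¹) • x₀ = x₀ := by
    rw [← MulAction.mem_stabilizer_iff, hA]
    exact har
  have h1 := h 1
  rw [hFc, orbitCocycle, if_pos ho, hfix] at h1
  have h2 : r⁻¹ * (r * a * r⁻¹) * r * 1 = k * 1 := congrArg Prod.snd h1
  have h3 : a = k := by
    rw [mul_one, mul_one] at h2
    rw [← h2]
    group
  exact h3 ▸ hk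

end Intersection

theorem lemma6p3 {B W : Type*} [Finite B] [Group W] {M : CoxeterMatrix B}
    (cs : CoxeterSystem M W) (hodd : M.IsOddAngled)
    {G : M.divGraph.ConnectedComponent → Type*} [∀ c, Group (G c)]
    (cs' : ∀ c, CoxeterSystem (M.restrict c.supp) (G c)) :
    (∃ φ : Monoid.CoprodI G ≃* W, ∀ (c : M.divGraph.ConnectedComponent) (b : c.supp),
      φ (Monoid.CoprodI.of ((cs' c).simple b)) = cs.simple b) ∧
    (cs.HasProperFiniteIndexReflectionSubgroup ↔
      ∃ c, (cs' c).HasProperFiniteIndexReflectionSubgroup) := by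
  refine ⟨⟨coprodEquiv cs cs', fun c b => ?_⟩, ?_, fun ⟨c, hc⟩ =>
    hasProperFiniteIndexReflectionSubgroup_of_component cs cs' hc⟩
  · rw [coprodEquiv_of, componentHom_simple]
  · rintro ⟨V, hV, hne, hfin⟩
    by_contra! hno
    refine hne ((Subgroup.eq_top_iff' V).2 fun w => ?_)
    induction w using cs.simple_induction with
    | simple b =>
      obtain ⟨c, b', hb⟩ := exists_component_simple cs cs' b
      have htop : V.comap (componentHom cs cs' c) = ⊤ := by
        by_contra hne'
        exact hno c ⟨_, isReflectionSubgroup_comap_componentHom cs cs' hV c, hne',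
          finiteIndex_comap _ _⟩
      rw [hb, ← Subgroup.mem_comap, htop]
      exact Subgroup.mem_top _
    | one => exact one_mem V
    | mul w w' hw hw' => exact mul_mem hw hw'
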